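/- Let $K\subset\mathbb{R}^3$ be a knot (a simple closed polygon), let $\overline{K}$ be its complement, i.e. $S^3=\mathbb{R}^3\cup\{\infty\}$ with an open regular neighbourhood of $K$ removed, and let $\mathcal{T}$ be a one-vertex triangulation of $\overline{K}$ with $n$ tetrahedra. Here a triangulation is a generalised one: $n$ abstract tetrahedra, some or all of whose $4n$ triangular faces are affinely glued in pairs (two different faces of the same tetrahedron may be glued together), with quotient space homeomorphic to $\overline{K}$; it is one-vertex if all $4n$ tetrahedron vertices become identified to a single point $V$. A normal surface in $\mathcal{T}$ is a properly embedded surface $S$ that meets each tetrahedron in a (possibly empty) finite collection of pairwise disjoint curvilinear triangles, each truncating one of the four vertices of the tetrahedron, and curvilinear quadrilaterals, each separating the four vertices into two pairs. Its vector $\mathbf{v}(S)\in\mathbb{Z}^{7n}$ counts, for each tetrahedron, the triangles of each of the four types (the $4n$ triangle coordinates) and the quadrilaterals of each of the three types (the $3n$ quadrilateral coordinates). The vertex link is the frontier of a small regular neighbourhood of $V$, that is, of a neighbourhood that meets each tetrahedron in four disjoint regions, each cut off around one vertex of the tetrahedron by a curvilinear triangle; it is a normal surface, well defined up to isotopies that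 preserve every cell of $\mathcal{T}$. Then a connected (in particular non-empty) normal surface $S$ in $\mathcal{T}$ is the vertex link if and only if none of the $4n$ triangle coordinates of $\mathbf{v}(S)$ is equal to zero. -/

import Mathlib

noncomputable section

/-! ### The model tetrahedron and its normal discs -/

/-- The model tetrahedron, in barycentric coordinates. -/
abbrev Tetrahedron : Type := stdSimplex ℝ (Fin 4)

namespace Tetrahedron

/-- The `i`-th vertex. The `i`-th facet, opposite to it, is `{x | x i = 0}`. -/
def vertex (i : Fin 4) : Tetrahedron := ⟨Pi.single i 1, single_mem_stdSimplex ℝ i⟩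

/-- A self-homeomorphism of the tetrahedron that maps every facet, and hence every
edge and every vertex, to itself. -/
def FacePreserving (h : Tetrahedron ≃ₜ Tetrahedron) : Prop :=
  ∀ (x : Tetrahedron) (i : Fin 4), (h x).1 i = 0 ↔ x.1 i = 0

/-- The seven normal disc types: `tri i` truncates the vertex `i`, and `quad k` separates
the vertices `0` and `k + 1` from the other two. -/
inductive DiscType
  | tri (i : Fin 4)
  | quad (k : Fin 3)

/-- The flat model of each normal disc type. -/
def modelDisc : DiscType → Set Tetrahedron
  | .tri i => {x | x.1 i = 1 / 2}
  | .quad k => {x | x.1 0 + x.1 k.succ = 1 / 2}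

/-- A (tame) curvilinear triangle or quadrilateral of the given type: the image of the flat
model under a homeomorphism of the tetrahedron that preserves all its faces. -/
def IsNormalDisc (τ : DiscType) (D : Set Tetrahedron) : Prop :=
  ∃ h : Tetrahedron ≃ₜ Tetrahedron, FacePreserving h ∧ D = h '' modelDisc τ

/-- A conical neighbourhood of the vertex `i` in the tetrahedron: the closed region around
vertex `i` that a curvilinear triangle truncating this vertex cuts off. -/
def IsCornerNbhd (i : Fin 4) (C : Set Tetrahedron) : Prop :=
  ∃ h : Tetrahedron ≃ₜ Tetrahedron, FacePreserving h ∧ C = h '' {x | 1 / 2 ≤ x.1 i}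

end Tetrahedron

/-! ### Generalised triangulations -/

/-- A generalised triangulation: `n` abstract tetrahedra with some or all of their `4n` facets
glued affinely in pairs. `glue t f = some (t', σ)` says that facet `f` of tetrahedron `t` is
glued to facet `σ f` of tetrahedron `t'`, where for `j ≠ f` vertex `j` of `t` goes to
vertex `σ j` of `t'`; `glue t f = none` says that the facet is not glued. -/
structure GenTriangulation (n : ℕ) where
  glue : Fin n → Fin 4 → Option (Fin n × Equiv.Perm (Fin 4))
  glue_symm : ∀ t f t' σ, glue t f = some (t', σ) → glue t' (σ f) = some (t, σ⁻¹)
  glue_ne : ∀ t f t' σ, glue t f = some (t', σ) → (t', σ f) ≠ (t, f)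

namespace GenTriangulation

variable {n : ℕ}

/-- The elementary identifications of points given by the facet gluings. -/
def Glued (T : GenTriangulation n) (p q : Fin n × Tetrahedron) : Prop :=
  ∃ (f : Fin 4) (σ : Equiv.Perm (Fin 4)), T.glue p.1 f = some (q.1, σ) ∧
    p.2.1 f = 0 ∧ ∀ j, q.2.1 (σ j) = p.2.1 j

/-- The underlying space: the quotient of the disjoint union of the `n` tetrahedra by the
equivalence relation that the gluings generate, with the quotient topology. -/
def Space (T : GenTriangulation n) : Type := Quot T.Glued

instance (T : GenTriangulation n) : TopologicalSpace T.Space :=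
  inferInstanceAs (TopologicalSpace (Quot T.Glued))

/-- The characteristic map of tetrahedron `t`. -/
def toSpace (T : GenTriangulation n) (t : Fin n) (x : Tetrahedron) : T.Space :=
  Quot.mk T.Glued (t, x)

/-- The vertices of the triangulation: the points to which the `4n` tetrahedron vertices
are identified. -/
def vertexSet (T : GenTriangulation n) : Set T.Space :=
  {V | ∃ t i, T.toSpace t (Tetrahedron.vertex i) = V}

end GenTriangulation

/-! ### Knot complements -/

/-- A knot: a simple closed polygon in `ℝ³`, with corners `p 0, …, p (m - 1)` in cyclic order. -/
def IsPolygonalKnot (K : Set (EuclideanSpace ℝ (Fin 3))) : Prop :=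
  ∃ (m : ℕ) (_ : 3 ≤ m) (p : ZMod m → EuclideanSpace ℝ (Fin 3)),
    Function.Injective p ∧
    (∀ i, segment ℝ (p i) (p (i + 1)) ∩ segment ℝ (p (i + 1)) (p (i + 2)) = {p (i + 1)}) ∧
    (∀ i j, j ≠ i → j ≠ i + 1 → i ≠ j + 1 →
      Disjoint (segment ℝ (p i) (p (i + 1))) (segment ℝ (p j) (p (j + 1)))) ∧
    K = ⋃ i, segment ℝ (p i) (p (i + 1))

/-- `M` is (homeomorphic to) the complement of a knot `K`: the 3-sphere `ℝ³ ∪ {∞}` with an open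
regular neighbourhood of `K` removed. The regular neighbourhood is the open unit disc bundle in
a tubular neighbourhood `φ : S¹ × ℝ² → ℝ³` whose core `S¹ × {0}` is mapped onto `K`. -/
def IsKnotComplement (M : Type) [TopologicalSpace M] : Prop :=
  ∃ (K : Set (EuclideanSpace ℝ (Fin 3)))
    (φ : Circle × EuclideanSpace ℝ (Fin 2) → EuclideanSpace ℝ (Fin 3)),
    IsPolygonalKnot K ∧ Topology.IsOpenEmbedding φ ∧ φ '' (Set.univ ×ˢ {0}) = K ∧
    Nonempty (M ≃ₜ
      ↥((((↑) : EuclideanSpace ℝ (Fin 3) → OnePoint (EuclideanSpace ℝ (Fin 3))) ''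
        (φ '' (Set.univ ×ˢ Metric.ball 0 1)))ᶜ))

/-! ### Normal surfaces and vertex links -/

open Tetrahedron

/-- A normal surface: a subset of the underlying space that meets each tetrahedron in a (possibly
empty) finite collection of pairwise disjoint curvilinear triangles and quadrilaterals. Such a
subset of a triangulated 3-manifold is automatically a properly embedded surface, and
`pieces` is determined by `carrier`, as the set of connected components in each tetrahedron. -/
structure NormalSurface {n : ℕ} (T : GenTriangulation n) where
  carrier : Set T.Space
  pieces : Fin n → Set (Set Tetrahedron)
  pieces_finite : ∀ t, (pieces t).Finite
  pieces_disjoint : ∀ t, (pieces t).PairwiseDisjoint id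
  pieces_normal : ∀ t, ∀ D ∈ pieces t, ∃ τ, IsNormalDisc τ D
  preimage_carrier : ∀ t, T.toSpace t ⁻¹' carrier = ⋃₀ pieces t

/-- The vector `v(S) ∈ ℤ^{7n}`, which counts the normal discs of each type in each tetrahedron. -/
def NormalSurface.vector {n : ℕ} {T : GenTriangulation n} (S : NormalSurface T) :
    Fin n × DiscType → ℤ :=
  fun c => (Set.ncard {D | D ∈ S.pieces c.1 ∧ IsNormalDisc c.2 D} : ℤ)

namespace GenTriangulation

variable {n : ℕ}

/-- `N` is a small regular neighbourhood of the vertex `V`: it meets each tetrahedron exactly in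
disjoint conical neighbourhoods of those tetrahedron vertices that are identified to `V`. -/
def IsSmallRegularNbhd (T : GenTriangulation n) (V : T.Space) (N : Set T.Space) : Prop :=
  ∀ t, ∃ C : Fin 4 → Set Tetrahedron, (∀ i, IsCornerNbhd i (C i)) ∧
    Pairwise (fun i j => Disjoint (C i) (C j)) ∧
    T.toSpace t ⁻¹' N = ⋃ i ∈ {i | T.toSpace t (vertex i) = V}, C i

/-- `L` is the link of the vertex `V`: the frontier of a small regular neighbourhood of `V`. (The
link is a surface up to isotopy that preserves all cells, so each such frontier
counts as the link.) -/
def IsVertexLink (T : GenTriangulation n) (V : T.Space) (L : Set T.Space) : Prop :=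
  ∃ N, T.IsSmallRegularNbhd V N ∧ L = frontier N

end GenTriangulation

end

/-! ### Preconnected sets and disjoint closed covers -/

/-! A vertex link meets each tetrahedron in four triangles, one per corner
(`preimage_frontier_of_corners`). The pieces of a normal surface are recovered from its carrier as
connected components (`mem_pieces_of_preimage_eq`), so no triangle coordinate of the link vanishes.

Conversely, suppose that all triangle types occur. At every corner of every tetrahedron take the
innermost triangle (`exists_innermost`); the surface does not enter the corner beyond it. Across a
glued facet these corners must match: the open part of one corner in the facet is connected,
contains the vertex and misses S, so it cannot cross the innermost triangle on the other side
(`permute_mem_corner`). The corners therefore form a regular neighbourhood N of V, whose frontier is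
the union of the innermost triangles. Both this frontier and the union of the remaining discs of S
are closed. Since S is connected and the frontier is non-empty, S is the frontier. -/

theorem IsPreconnected.subset_of_subset_sUnion_of_isClosed {X : Type*} [TopologicalSpace X]
    {K : Set X} (hK : IsPreconnected K) (hne : K.Nonempty) {P : Set (Set X)} (hfin : P.Finite)
    (hdisj : P.PairwiseDisjoint id) (hclosed : ∀ D ∈ P, IsClosed D) (hsub : K ⊆ ⋃₀ P) :
    ∃ D ∈ P, K ⊆ D := by
  obtain ⟨x, hx⟩ := hne
  obtain ⟨D, hD, hxD⟩ := hsub hx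
  refine ⟨D, hD, ?_⟩
  -- By finiteness the other members have a closed union, so `K` would be split by two disjoint
  -- closed sets.
  have hrest : IsClosed (⋃₀ (P \ {D})) :=
    Set.sUnion_eq_biUnion ▸ (hfin.subset Set.sdiff_subset).isClosed_biUnion fun E hE => hclosed E hE.1
  have hdis : Disjoint D (⋃₀ (P \ {D})) :=
    Set.disjoint_sUnion_right.2 fun E hE => hdisj hD hE.1 (Ne.symm hE.2)
  rcases isPreconnected_iff_subset_of_disjoint_closed.1 hK D (⋃₀ (P \ {D})) (hclosed D hD) hrest
    (fun y hy => by
      obtain ⟨E, hE, hyE⟩ := hsub hy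
      by_cases h : E = D
      · exact Or.inl (h ▸ hyE)
      · exact Or.inr ⟨E, ⟨hE, h⟩, hyE⟩)
    (by rw [hdis.inter_eq, Set.inter_empty]) with h | h
  · exact h
  · exact absurd (h hx) (Set.disjoint_left.1 hdis hxD)

/-- A preconnected set on which a real function avoids a value lies on one side of it. -/
theorem IsPreconnected.lt_of_forall_ne {X : Type*} [TopologicalSpace X] {K : Set X}
    (hK : IsPreconnected K) {g : X → ℝ} (hg : Continuous g) {c : ℝ} (hne : ∀ x ∈ K, g x ≠ c)
    {x y : X} (hx : x ∈ K) (hxc : g x < c) (hy : y ∈ K) : g y < c := by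
  by_contra! h
  obtain ⟨z, hz, hzc⟩ := hK.intermediate_value hx hy hg.continuousOn ⟨hxc.le, h⟩
  exact hne z hz hzc

theorem IsPreconnected.gt_of_forall_ne {X : Type*} [TopologicalSpace X] {K : Set X}
    (hK : IsPreconnected K) {g : X → ℝ} (hg : Continuous g) {c : ℝ} (hne : ∀ x ∈ K, g x ≠ c)
    {x y : X} (hx : x ∈ K) (hxc : c < g x) (hy : y ∈ K) : c < g y := by
  by_contra! h
  obtain ⟨z, hz, hzc⟩ := hK.intermediate_value hy hx hg.continuousOn ⟨h, hxc.le⟩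
  exact hne z hz hzc

namespace Tetrahedron

/-! ### The geometry of the model tetrahedron -/

theorem coord_sum (x : Tetrahedron) : ∑ i, x.1 i = 1 := x.2.2

theorem continuous_coord (i : Fin 4) : Continuous fun x : Tetrahedron => x.1 i :=
  (continuous_apply i).comp continuous_subtype_val

@[simp] theorem vertex_self (i : Fin 4) : (vertex i).1 i = 1 := by simp [vertex]

@[simp] theorem vertex_ne {i j : Fin 4} (h : j ≠ i) : (vertex i).1 j = 0 := by simp [vertex, h]

theorem eq_vertex {x : Tetrahedron} {i : Fin 4} (h : ∀ j, j ≠ i → x.1 j = 0) : x = vertex i := by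
  have hi : x.1 i = 1 := by
    rw [← coord_sum x, Finset.sum_eq_single i (fun j _ hj => h j hj) (by simp)]
  refine Subtype.ext (funext fun j => ?_)
  by_cases hj : j = i
  · rw [hj, hi, vertex_self]
  · rw [h j hj, vertex_ne hj]

theorem isPreconnected_of_convex {s : Set (Fin 4 → ℝ)} (hs : Convex ℝ s) :
    IsPreconnected {x : Tetrahedron | x.1 ∈ s} := by
  rw [← Topology.IsInducing.subtypeVal.isPreconnected_image]
  have : Subtype.val '' {x : Tetrahedron | x.1 ∈ s} = stdSimplex ℝ (Fin 4) ∩ s := by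
    ext y
    constructor
    · rintro ⟨x, hx, rfl⟩
      exact ⟨x.2, hx⟩
    · rintro ⟨h1, h2⟩
      exact ⟨⟨y, h1⟩, h2, rfl⟩
  rw [this]
  exact ((convex_stdSimplex ℝ (Fin 4)).inter hs).isPreconnected

theorem convex_setOf_coord {s : Set ℝ} (hs : Convex ℝ s) (i : Fin 4) :
    Convex ℝ {x : Fin 4 → ℝ | x i ∈ s} :=
  hs.linear_preimage (LinearMap.proj (R := ℝ) (φ := fun _ : Fin 4 => ℝ) i)

/-- The midpoint of an edge. -/
noncomputable def edgeMidpoint (i j : Fin 4) : Tetrahedron :=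
  ⟨(1 / 2 : ℝ) • (vertex i).1 + (1 / 2 : ℝ) • (vertex j).1,
    convex_stdSimplex ℝ (Fin 4) (vertex i).2 (vertex j).2 (by norm_num) (by norm_num)
      (by norm_num)⟩

theorem edgeMidpoint_apply (i j k : Fin 4) :
    (edgeMidpoint i j).1 k = 1 / 2 * (vertex i).1 k + 1 / 2 * (vertex j).1 k := rfl

theorem edgeMidpoint_left {i j : Fin 4} (h : i ≠ j) : (edgeMidpoint i j).1 i = 1 / 2 := by
  simp [edgeMidpoint_apply, h]

theorem edgeMidpoint_of_ne {i j k : Fin 4} (hi : k ≠ i) (hj : k ≠ j) :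
    (edgeMidpoint i j).1 k = 0 := by
  simp [edgeMidpoint_apply, hi, hj]

/-- The point that divides the segment from `x` to vertex `j` in the ratio `s : 1 - s`. -/
noncomputable def towards (j : Fin 4) (x : Tetrahedron) (s : unitInterval) : Tetrahedron :=
  ⟨(1 - s.1) • x.1 + s.1 • (vertex j).1,
    convex_stdSimplex ℝ (Fin 4) x.2 (vertex j).2 (by linarith [s.2.2]) s.2.1 (by ring)⟩

theorem towards_apply (j : Fin 4) (x : Tetrahedron) (s : unitInterval) (k : Fin 4) :
    (towards j x s).1 k = (1 - s.1) * x.1 k + s.1 * (vertex j).1 k := rfl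

/-- Moving a point slightly towards vertex `j` stays in the faces that contain both. -/
theorem mem_closure_of_towards {j : Fin 4} {x : Tetrahedron} {P : Set Tetrahedron}
    (h : ∀ s : unitInterval, 0 < s.1 → s.1 < 1 → towards j x s ∈ P) : x ∈ closure P := by
  have hcont : Continuous (towards j x) :=
    Continuous.subtype_mk (by fun_prop) _
  have h0 : towards j x 0 = x := Subtype.ext (by simp [towards])
  -- The shift by 2 keeps the parameter strictly below 1 even for `m = 0`.
  have hlim : Filter.Tendsto (fun m : ℕ => ((1 : ℝ) / ((m : ℝ) + 2))) Filter.atTop (nhds 0) := by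
    have := (tendsto_one_div_add_atTop_nhds_zero_nat (𝕜 := ℝ)).comp (Filter.tendsto_add_atTop_nat 1)
    refine this.congr fun m => ?_
    simp only [Function.comp_apply]
    push_cast
    ring_nf
  have hb (m : ℕ) : 0 < (1 : ℝ) / ((m : ℝ) + 2) ∧ (1 : ℝ) / ((m : ℝ) + 2) < 1 := by
    have hm : (0 : ℝ) ≤ m := m.cast_nonneg
    exact ⟨by positivity, by rw [div_lt_one (by positivity)]; linarith⟩
  let u : ℕ → unitInterval := fun m => ⟨1 / ((m : ℝ) + 2), (hb m).1.le, (hb m).2.le⟩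
  have hu : Filter.Tendsto u Filter.atTop (nhds 0) := tendsto_subtype_rng.2 hlim
  have := (hcont.tendsto 0).comp hu
  rw [h0] at this
  exact mem_closure_of_tendsto this (Filter.Eventually.of_forall fun m => h _ (hb m).1 (hb m).2)

theorem exists_ne_ne (i f : Fin 4) : ∃ j, j ≠ i ∧ j ≠ f := by
  revert i f; decide

/-! ### Triangles cutting off a vertex -/

/-- The `i`-th barycentric coordinate, transported by the homeomorphism `h`. -/
noncomputable def height (h : Tetrahedron ≃ₜ Tetrahedron) (i : Fin 4) (x : Tetrahedron) : ℝ := (h.symm x).1 i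

theorem continuous_height (h : Tetrahedron ≃ₜ Tetrahedron) (i : Fin 4) :
    Continuous (height h i) := (continuous_coord i).comp h.symm.continuous

theorem image_setOf_coord (h : Tetrahedron ≃ₜ Tetrahedron) (i : Fin 4) (s : Set ℝ) :
    h '' {x | x.1 i ∈ s} = {x | height h i x ∈ s} := by
  rw [h.image_eq_preimage_symm]; rfl

theorem image_modelDisc_tri (h : Tetrahedron ≃ₜ Tetrahedron) (i : Fin 4) :
    h '' modelDisc (.tri i) = {x | height h i x = 1 / 2} := image_setOf_coord h i {1 / 2}

theorem image_corner (h : Tetrahedron ≃ₜ Tetrahedron) (i : Fin 4) :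
    h '' {x | 1 / 2 ≤ x.1 i} = {x | 1 / 2 ≤ height h i x} := image_setOf_coord h i (Set.Ici (1 / 2))

theorem isPreconnected_height (h : Tetrahedron ≃ₜ Tetrahedron) (i : Fin 4) {s : Set ℝ}
    (hs : Convex ℝ s) : IsPreconnected {x | height h i x ∈ s} := by
  rw [← image_setOf_coord]
  exact (isPreconnected_of_convex (convex_setOf_coord hs i)).image _ h.continuous.continuousOn

namespace FacePreserving

variable {h : Tetrahedron ≃ₜ Tetrahedron}

theorem symm (hh : FacePreserving h) : FacePreserving h.symm := fun x i => by
  rw [← hh (h.symm x) i, h.apply_symm_apply]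

theorem height_eq_zero (hh : FacePreserving h) (i : Fin 4) (x : Tetrahedron) :
    height h i x = 0 ↔ x.1 i = 0 := hh.symm x i

theorem symm_vertex (hh : FacePreserving h) (i : Fin 4) : h.symm (vertex i) = vertex i :=
  eq_vertex fun j hj => (hh.symm (vertex i) j).2 (vertex_ne hj)

theorem height_vertex (hh : FacePreserving h) (i : Fin 4) : height h i (vertex i) = 1 := by
  rw [height, hh.symm_vertex, vertex_self]

/-- Since `h` preserves facets, this set is the image of a convex slice of the simplex. -/
theorem isPreconnected_height_facet (hh : FacePreserving h) (i f : Fin 4) {s : Set ℝ}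
    (hs : Convex ℝ s) : IsPreconnected {x | height h i x ∈ s ∧ x.1 f = 0} := by
  have : {x | height h i x ∈ s ∧ x.1 f = 0} =
      h '' {x : Tetrahedron | x.1 ∈ {y : Fin 4 → ℝ | y i ∈ s} ∩ {y | y f ∈ ({0} : Set ℝ)}} := by
    rw [h.image_eq_preimage_symm]
    ext x
    exact and_congr Iff.rfl (hh.symm x f).symm
  rw [this]
  exact (isPreconnected_of_convex ((convex_setOf_coord hs i).inter
    (convex_setOf_coord (convex_singleton 0) f))).image _ h.continuous.continuousOn

/-- In model coordinates, move towards a vertex other than `i` and `f`: this lowers coordinate `i`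
and does not leave facet `f`. The facet clause allows interiority to be tested inside a single
facet. -/
theorem mem_closure_lower (hh : FacePreserving h) {i f : Fin 4} {x : Tetrahedron}
    (hx : height h i x = 1 / 2) :
    x ∈ closure {y | height h i y < 1 / 2 ∧ (x.1 f = 0 → y.1 f = 0)} := by
  obtain ⟨j, hji, hjf⟩ := exists_ne_ne i f
  have hx' : (h.symm x).1 i = 1 / 2 := hx
  have key : h.symm x ∈ closure {y : Tetrahedron | y.1 i < 1 / 2 ∧ (x.1 f = 0 → y.1 f = 0)} := by
    refine mem_closure_of_towards (j := j) fun s hs0 hs1 => ⟨?_, fun hf => ?_⟩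
    · rw [towards_apply, vertex_ne hji.symm, hx']
      linarith
    · rw [towards_apply, vertex_ne hjf.symm, (hh.symm x f).2 hf]
      ring
  have := image_closure_subset_closure_image h.continuous (Set.mem_image_of_mem h key)
  rw [h.apply_symm_apply] at this
  refine closure_mono ?_ this
  rintro _ ⟨y, ⟨hy1, hy2⟩, rfl⟩
  exact ⟨by rwa [height, h.symm_apply_apply], fun hf => (hh y f).2 (hy2 hf)⟩

/-- In model coordinates, move towards vertex `i`. It lies in facet `f`, because coordinate `i` is
positive at the given point while coordinate `f` vanishes. -/
theorem mem_closure_upper (hh : FacePreserving h) {i f : Fin 4} {x : Tetrahedron}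
    (hx : 1 / 2 ≤ height h i x) (hf : x.1 f = 0) :
    x ∈ closure {y | 1 / 2 < height h i y ∧ y.1 f = 0} := by
  have hx' : 1 / 2 ≤ (h.symm x).1 i := hx
  have hfx : (h.symm x).1 f = 0 := (hh.symm x f).2 hf
  have hfi : f ≠ i := by
    rintro rfl
    rw [hfx] at hx'
    norm_num at hx'
  have key : h.symm x ∈ closure {y : Tetrahedron | 1 / 2 < y.1 i ∧ y.1 f = 0} := by
    refine mem_closure_of_towards (j := i) fun s hs0 hs1 => ⟨?_, ?_⟩
    · rw [towards_apply, vertex_self]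
      nlinarith
    · rw [towards_apply, vertex_ne hfi, hfx]
      ring
  have := image_closure_subset_closure_image h.continuous (Set.mem_image_of_mem h key)
  rw [h.apply_symm_apply] at this
  refine closure_mono ?_ this
  rintro _ ⟨y, ⟨hy1, hy2⟩, rfl⟩
  exact ⟨by rwa [height, h.symm_apply_apply], (hh y f).2 hy2⟩

theorem nonempty_disc (h : Tetrahedron ≃ₜ Tetrahedron) (i : Fin 4) :
    {x | height h i x = 1 / 2}.Nonempty := by
  obtain ⟨j, hj, -⟩ := exists_ne_ne i i
  exact ⟨h (edgeMidpoint i j), by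
    rw [Set.mem_ofPred_eq, height, h.symm_apply_apply, edgeMidpoint_left hj.symm]⟩

end FacePreserving

/-! ### Normal discs -/

theorem isClosed_modelDisc (τ : DiscType) : IsClosed (modelDisc τ) := by
  cases τ with
  | tri i => exact isClosed_eq (continuous_coord i) continuous_const
  | quad k => exact isClosed_eq ((continuous_coord 0).add (continuous_coord k.succ)) continuous_const

theorem isPreconnected_modelDisc (τ : DiscType) : IsPreconnected (modelDisc τ) := by
  cases τ with
  | tri i => exact isPreconnected_of_convex (convex_setOf_coord (convex_singleton (1 / 2)) i)
  | quad k =>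
    exact isPreconnected_of_convex ((convex_singleton (1 / 2 : ℝ)).linear_preimage
      (LinearMap.proj (R := ℝ) (φ := fun _ : Fin 4 => ℝ) 0 +
        LinearMap.proj (R := ℝ) (φ := fun _ : Fin 4 => ℝ) k.succ))

/-- Only the triangles that truncate vertex `i` miss the facet opposite to it. -/
theorem exists_mem_modelDisc_coord_eq_zero {τ : DiscType} {i : Fin 4} (hτ : τ ≠ .tri i) :
    ∃ x ∈ modelDisc τ, x.1 i = 0 := by
  cases τ with
  | tri j =>
    have hij : i ≠ j := fun h => hτ (by rw [h])
    obtain ⟨k, hki, hkj⟩ := exists_ne_ne i j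
    exact ⟨edgeMidpoint j k, edgeMidpoint_left hkj.symm, edgeMidpoint_of_ne hij hki.symm⟩
  | quad k =>
    -- An edge in the facet opposite `i` with exactly one end in `{0, k + 1}`; its midpoint lies on
    -- the model quadrilateral.
    have : ∃ a b : Fin 4, i ≠ a ∧ i ≠ b ∧ a ≠ b ∧
        ((a = 0 ∧ b ≠ k.succ) ∨ (a = k.succ ∧ b ≠ 0)) := by
      clear hτ; revert i k; decide
    obtain ⟨a, b, hia, hib, hab, h⟩ := this
    refine ⟨edgeMidpoint a b, ?_, edgeMidpoint_of_ne hia hib⟩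
    have hk : k.succ ≠ 0 := k.succ_ne_zero
    change (edgeMidpoint a b).1 0 + (edgeMidpoint a b).1 k.succ = 1 / 2
    rcases h with ⟨rfl, hb⟩ | ⟨rfl, hb⟩
    · rw [edgeMidpoint_left hab, edgeMidpoint_of_ne hk hb.symm, add_zero]
    · rw [edgeMidpoint_left hab, edgeMidpoint_of_ne hk.symm hb.symm, zero_add]

namespace IsNormalDisc

variable {τ : DiscType} {D : Set Tetrahedron}

theorem isClosed (hD : IsNormalDisc τ D) : IsClosed D := by
  obtain ⟨h, -, rfl⟩ := hD
  exact h.isClosedMap _ (isClosed_modelDisc τ)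

theorem isPreconnected (hD : IsNormalDisc τ D) : IsPreconnected D := by
  obtain ⟨h, -, rfl⟩ := hD
  exact (isPreconnected_modelDisc τ).image _ h.continuous.continuousOn

theorem exists_coord_eq_zero (hD : IsNormalDisc τ D) {i : Fin 4} (hτ : τ ≠ .tri i) :
    ∃ x ∈ D, x.1 i = 0 := by
  obtain ⟨h, hh, rfl⟩ := hD
  obtain ⟨x, hx, hxi⟩ := exists_mem_modelDisc_coord_eq_zero hτ
  exact ⟨h x, ⟨x, hx, rfl⟩, (hh x i).2 hxi⟩

theorem nonempty (hD : IsNormalDisc τ D) : D.Nonempty := by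
  obtain ⟨i, hi⟩ : ∃ i, τ ≠ .tri i := by
    cases τ with
    | tri j =>
      obtain ⟨i, hi, -⟩ := exists_ne_ne j j
      exact ⟨i, fun h => hi (DiscType.tri.inj h).symm⟩
    | quad k => exact ⟨0, fun h => nomatch h⟩
  obtain ⟨x, hx, -⟩ := hD.exists_coord_eq_zero hi
  exact ⟨x, hx⟩

end IsNormalDisc

theorem isNormalDisc_height {h : Tetrahedron ≃ₜ Tetrahedron} (hh : FacePreserving h) (i : Fin 4) :
    IsNormalDisc (.tri i) {x | height h i x = 1 / 2} :=
  ⟨h, hh, (image_modelDisc_tri h i).symm⟩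

/-- A normal disc of another type lies beyond any triangle truncating vertex `i` which it does
not meet. -/
theorem height_lt_of_isNormalDisc {h : Tetrahedron ≃ₜ Tetrahedron} (hh : FacePreserving h)
    {i : Fin 4} {τ : DiscType} {D : Set Tetrahedron} (hD : IsNormalDisc τ D) (hτ : τ ≠ .tri i)
    (hdis : Disjoint {x | height h i x = 1 / 2} D) {x : Tetrahedron} (hx : x ∈ D) :
    height h i x < 1 / 2 := by
  -- The disc meets the facet opposite `i`, where the height is 0, and being connected it cannot
  -- cross the level 1/2.
  obtain ⟨y, hy, hyi⟩ := hD.exists_coord_eq_zero hτ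
  refine hD.isPreconnected.lt_of_forall_ne (continuous_height h i)
    (fun z hz hz' => Set.disjoint_left.1 hdis hz' hz) hy ?_ hx
  rw [(hh.height_eq_zero i y).2 hyi]
  norm_num

/-- In a finite disjoint family of normal discs with a triangle truncating vertex `i`, there is an
innermost one: the rest of the family lies beyond it. -/
theorem exists_innermost {P : Set (Set Tetrahedron)} (hfin : P.Finite)
    (hdisj : P.PairwiseDisjoint id) (hnormal : ∀ D ∈ P, ∃ τ, IsNormalDisc τ D) {i : Fin 4}
    (hne : {D | D ∈ P ∧ IsNormalDisc (.tri i) D}.Nonempty) :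
    ∃ h, FacePreserving h ∧ {x | height h i x = 1 / 2} ∈ P ∧
      ∀ x ∈ ⋃₀ P, height h i x ≤ 1 / 2 := by
  have hex (D : Set Tetrahedron) : ∃ h : Tetrahedron ≃ₜ Tetrahedron, IsNormalDisc (.tri i) D →
      FacePreserving h ∧ D = {x | height h i x = 1 / 2} := by
    by_cases hD : IsNormalDisc (.tri i) D
    · obtain ⟨h, hh, hD'⟩ := hD
      exact ⟨h, fun _ => ⟨hh, by rw [hD', image_modelDisc_tri]⟩⟩
    · exact ⟨Homeomorph.refl _, fun h => absurd h hD⟩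
  choose H hH using hex
  -- Innermost means that the corner cut off is minimal under inclusion.
  obtain ⟨D, ⟨hDP, hD⟩, hmin⟩ := Set.Finite.exists_minimalFor
    (fun D => {x | 1 / 2 ≤ height (H D) i x}) _ (hfin.subset fun D hD => hD.1) hne
  obtain ⟨hh, hDeq⟩ := hH D hD
  refine ⟨H D, hh, hDeq ▸ hDP, ?_⟩
  rintro x ⟨E, hE, hxE⟩
  by_cases hED : E = D
  · have hx : x ∈ {x | height (H D) i x = 1 / 2} := hDeq ▸ hED ▸ hxE
    exact le_of_eq hx
  have hdis : Disjoint D E := hdisj hDP hE (Ne.symm hED)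
  obtain ⟨τ, hτ⟩ := hnormal E hE
  by_cases hτi : τ = .tri i
  swap
  · exact (height_lt_of_isNormalDisc hh hτ hτi (hDeq ▸ hdis) hxE).le
  subst hτi
  obtain ⟨hh', hEeq⟩ := hH E hτ
  by_contra! hx
  -- If a triangle `E` of the same type enters the corner of `D`, all of it lies there. The outer
  -- side of `D` is then connected and misses `E`, so the corner of `E` lies strictly inside that of
  -- `D`, against minimality.
  have hEside : ∀ y ∈ E, 1 / 2 < height (H D) i y := fun y hy =>
    hτ.isPreconnected.gt_of_forall_ne (continuous_height _ i)
      (fun z hz hz' => Set.disjoint_left.1 hdis (hDeq.symm ▸ hz') hz) hxE hx hy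
  obtain ⟨j, hj, -⟩ := exists_ne_ne i i
  have hvj (g : Tetrahedron ≃ₜ Tetrahedron) (hg : FacePreserving g) :
      height g i (vertex j) < 1 / 2 := by
    rw [(hg.height_eq_zero i _).2 (vertex_ne hj.symm)]
    norm_num
  have hlow : ∀ y, height (H D) i y ≤ 1 / 2 → height (H E) i y < 1 / 2 := fun y hy =>
    (isPreconnected_height (H D) i (convex_Iic (1 / 2))).lt_of_forall_ne (continuous_height _ i)
      (fun z hz hz' => not_lt.2 hz (hEside z (by rw [hEeq]; exact hz')))
      (hvj _ hh).le (hvj _ hh') hy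
  have hsub : {x | 1 / 2 ≤ height (H E) i x} ⊆ {x | 1 / 2 ≤ height (H D) i x} := fun y hy => by
    by_contra hy'
    exact absurd (hlow y (not_le.1 hy').le) (not_lt.2 hy)
  obtain ⟨y, hy⟩ := FacePreserving.nonempty_disc (H D) i
  have hy' : y ∈ {x | 1 / 2 ≤ height (H E) i x} := hmin ⟨hE, hτ⟩ hsub (le_of_eq hy.symm)
  exact absurd (hlow y (le_of_eq hy)) (not_lt.2 hy')

/-- Disjoint triangles truncating different vertices cut off disjoint corners. -/
theorem disjoint_corners {g h : Tetrahedron ≃ₜ Tetrahedron} (hg : FacePreserving g)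
    (hh : FacePreserving h) {i j : Fin 4} (hij : i ≠ j)
    (hdis : Disjoint {x | height g i x = 1 / 2} {x | height h j x = 1 / 2}) :
    Disjoint {x | 1 / 2 ≤ height g i x} {x | 1 / 2 ≤ height h j x} := by
  have hlt : ∀ x, height g i x = 1 / 2 → height h j x < 1 / 2 := fun x hx =>
    height_lt_of_isNormalDisc hh (isNormalDisc_height hg i) (fun e => hij (DiscType.tri.inj e))
      hdis.symm hx
  refine Set.disjoint_left.2 fun x hx hx' => absurd (?_ : height g i x < 1 / 2) (not_lt.2 hx)
  -- The corner at `j` is connected, misses the triangle at `i`, and contains vertex `j`, where the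
  -- height for `i` is 0.
  refine (isPreconnected_height h j (convex_Ici (1 / 2))).lt_of_forall_ne (continuous_height g i)
    (fun z hz hz' => not_lt.2 hz (hlt z hz')) (x := vertex j) ?_ ?_ hx'
  · change 1 / 2 ≤ height h j (vertex j)
    rw [hh.height_vertex]
    norm_num
  · rw [(hg.height_eq_zero i _).2 (vertex_ne hij)]
    norm_num

/-! ### Permuting the vertices -/

/-- The affine symmetry of the tetrahedron that takes vertex `j` to vertex `σ j`. -/
def permute (σ : Equiv.Perm (Fin 4)) (x : Tetrahedron) : Tetrahedron :=
  ⟨fun k => x.1 (σ⁻¹ k), fun k => x.2.1 _, by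
    rw [← x.2.2]
    exact Equiv.sum_comp σ⁻¹ x.1⟩

@[simp] theorem permute_apply (σ : Equiv.Perm (Fin 4)) (x : Tetrahedron) (j : Fin 4) :
    (permute σ x).1 (σ j) = x.1 j := by simp [permute]

theorem eq_permute {σ : Equiv.Perm (Fin 4)} {x y : Tetrahedron} (h : ∀ j, y.1 (σ j) = x.1 j) :
    y = permute σ x := by
  refine Subtype.ext (funext fun k => ?_)
  obtain ⟨j, rfl⟩ := σ.surjective k
  rw [h, permute_apply]

@[simp] theorem permute_inv_permute (σ : Equiv.Perm (Fin 4)) (x : Tetrahedron) :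
    permute σ⁻¹ (permute σ x) = x :=
  Subtype.ext (funext fun k => by simp [permute])

theorem continuous_permute (σ : Equiv.Perm (Fin 4)) : Continuous (permute σ) :=
  Continuous.subtype_mk (continuous_pi fun k => continuous_coord (σ⁻¹ k)) _

theorem permute_vertex (σ : Equiv.Perm (Fin 4)) (i : Fin 4) :
    permute σ (vertex i) = vertex (σ i) :=
  eq_vertex fun j hj => by
    obtain ⟨k, rfl⟩ := σ.surjective j
    rw [permute_apply, vertex_ne fun h => hj (by rw [h])]

end Tetrahedron

namespace GenTriangulation

open Tetrahedron

variable {n : ℕ} (T : GenTriangulation n)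

/-! ### Subsets of the underlying space -/

theorem toSpace_surjective (p : T.Space) : ∃ t x, T.toSpace t x = p := by
  obtain ⟨⟨t, x⟩, rfl⟩ := Quot.exists_rep p
  exact ⟨t, x, rfl⟩

theorem subset_of_preimage_subset {A B : Set T.Space}
    (h : ∀ t, T.toSpace t ⁻¹' A ⊆ T.toSpace t ⁻¹' B) : A ⊆ B := fun p hp => by
  obtain ⟨t, x, rfl⟩ := T.toSpace_surjective p
  exact h t hp

theorem continuous_toSpace (t : Fin n) : Continuous (T.toSpace t) :=
  continuous_quot_mk.comp (Continuous.prodMk_right t)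

theorem isOpen_of_preimage {W : Set T.Space} (h : ∀ t, IsOpen (T.toSpace t ⁻¹' W)) : IsOpen W := by
  have hU : (fun p : Fin n × Tetrahedron => T.toSpace p.1 p.2) ⁻¹' W =
      ⋃ t, {t} ×ˢ (T.toSpace t ⁻¹' W) := by
    ext ⟨t, x⟩
    simp
  have hopen : IsOpen ((fun p : Fin n × Tetrahedron => T.toSpace p.1 p.2) ⁻¹' W) := by
    rw [hU]
    exact isOpen_iUnion fun t => (isOpen_discrete _).prod (h t)
  exact isOpen_coinduced.2 hopen

theorem isClosed_of_preimage {W : Set T.Space} (h : ∀ t, IsClosed (T.toSpace t ⁻¹' W)) :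
    IsClosed W :=
  ⟨T.isOpen_of_preimage fun t => (h t).isOpen_compl⟩

variable {T}

theorem toSpace_permute {t t' : Fin n} {f : Fin 4} {σ : Equiv.Perm (Fin 4)}
    (hg : T.glue t f = some (t', σ)) {x : Tetrahedron} (hx : x.1 f = 0) :
    T.toSpace t' (permute σ x) = T.toSpace t x :=
  (Quot.sound ⟨f, σ, hg, hx, fun j => permute_apply σ x j⟩).symm

/-- A family of sets in the tetrahedra that respects the gluings in one direction comes from a
subset of the underlying space. -/
theorem exists_preimage_eq {U : Fin n → Set Tetrahedron}
    (hU : ∀ t f t' σ, T.glue t f = some (t', σ) → ∀ x : Tetrahedron, x.1 f = 0 → x ∈ U t →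
      permute σ x ∈ U t') :
    ∃ W : Set T.Space, ∀ t, T.toSpace t ⁻¹' W = U t := by
  -- The converse direction is the hypothesis applied to the inverse gluing.
  have hiff (t f t' σ) (hg : T.glue t f = some (t', σ)) (x : Tetrahedron) (hx : x.1 f = 0) :
      x ∈ U t ↔ permute σ x ∈ U t' := by
    refine ⟨hU t f t' σ hg x hx, fun h => ?_⟩
    have := hU t' (σ f) t σ⁻¹ (T.glue_symm _ _ _ _ hg) (permute σ x)
      (by rw [permute_apply, hx]) h
    rwa [permute_inv_permute] at this
  refine ⟨{p | Quot.lift (fun q : Fin n × Tetrahedron => q.2 ∈ U q.1) ?_ p}, fun t => rfl⟩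
  rintro ⟨t, x⟩ ⟨t', y⟩ ⟨f, σ, hg, hx, hy⟩
  obtain rfl := eq_permute hy
  exact propext (hiff t f t' σ hg x hx)

/-! ### The frontier of a union of corners -/

/-- The point is that the interior of `N` pulls back to the open corners. These are compatible with
the gluings because membership in an open corner can be detected from `N` within any one facet
through the point (`hint`); hence they descend to an open subset of `N`. -/
theorem preimage_frontier_of_corners {N : Set T.Space}
    {h : Fin n → Fin 4 → Tetrahedron ≃ₜ Tetrahedron} (hh : ∀ t i, FacePreserving (h t i))
    (hdis : ∀ t, Pairwise fun i j =>
      Disjoint {x | 1 / 2 ≤ height (h t i) i x} {x | 1 / 2 ≤ height (h t j) j x})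
    (hN : ∀ t, T.toSpace t ⁻¹' N = ⋃ i, {x | 1 / 2 ≤ height (h t i) i x}) (t : Fin n) :
    T.toSpace t ⁻¹' frontier N = ⋃ i, {x | height (h t i) i x = 1 / 2} := by
  have hclosed (t i) : IsClosed {x | 1 / 2 ≤ height (h t i) i x} :=
    isClosed_le continuous_const (continuous_height _ i)
  have hopen (t i) : IsOpen {x | 1 / 2 < height (h t i) i x} :=
    isOpen_lt continuous_const (continuous_height _ i)
  have hNclosed : IsClosed N := T.isClosed_of_preimage fun t => by
    rw [hN]
    exact isClosed_iUnion_of_finite (hclosed t)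
  have hsub (t) : ⋃ i, {x | 1 / 2 < height (h t i) i x} ⊆ T.toSpace t ⁻¹' N := by
    rw [hN]
    exact Set.iUnion_mono fun i x (hx : 1 / 2 < height (h t i) i x) => show 1 / 2 ≤ height (h t i) i x from hx.le
  have hint (t) (f : Fin 4) (x : Tetrahedron)
      (hx : ∀ᶠ y in nhds x, (x.1 f = 0 → y.1 f = 0) → T.toSpace t y ∈ N) :
      x ∈ ⋃ i, {x | 1 / 2 < height (h t i) i x} := by
    have hxN : x ∈ T.toSpace t ⁻¹' N := hx.self_of_nhds id
    rw [hN] at hxN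
    obtain ⟨i, hi⟩ := Set.mem_iUnion.1 hxN
    refine Set.mem_iUnion.2 ⟨i, show 1 / 2 < height (h t i) i x from lt_of_le_of_ne hi fun heq => ?_⟩
    -- The other corners are closed and miss `x`, so they stay away from a neighbourhood of `x`.
    -- Points just below the triangle are then in no corner, although they should map into `N`.
    have hnear : ∀ᶠ y in nhds x, ∀ j, j ≠ i → ¬ 1 / 2 ≤ height (h t j) j y := by
      refine Filter.eventually_all.2 fun j => ?_
      by_cases hj : j = i
      · exact Filter.Eventually.of_forall fun y h => absurd hj h
      · have := (hclosed t j).isOpen_compl.mem_nhds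
          (Set.disjoint_left.1 (hdis t (Ne.symm hj)) hi)
        filter_upwards [this] with y hy _ using hy
    obtain ⟨y, ⟨hy1, hy2⟩, hy3, hy4⟩ := ((mem_closure_iff_frequently.1
      ((hh t i).mem_closure_lower (f := f) heq.symm)).and_eventually (hx.and hnear)).exists
    have hyN : y ∈ T.toSpace t ⁻¹' N := hy3 hy2
    rw [hN] at hyN
    obtain ⟨j, hj⟩ := Set.mem_iUnion.1 hyN
    by_cases hji : j = i
    · subst hji
      exact not_lt.2 hj hy1
    · exact hy4 j hji hj
  obtain ⟨W, hW⟩ := exists_preimage_eq (T := T)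
    (U := fun t => ⋃ i, {x | 1 / 2 < height (h t i) i x}) (by
      intro t f t' σ hg x hx hxU
      -- Only points of the common facet can be pulled back to `t`, which is why `hint` asks for no
      -- others.
      refine hint t' (σ f) _ ?_
      have hev : ∀ᶠ y in nhds x, y ∈ ⋃ i, {x | 1 / 2 < height (h t i) i x} :=
        (isOpen_iUnion (hopen t)).mem_nhds hxU
      have htend : Filter.Tendsto (permute σ⁻¹) (nhds (permute σ x)) (nhds x) := by
        simpa using (continuous_permute σ⁻¹).tendsto (permute σ x)
      filter_upwards [htend.eventually hev] with y hy hyf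
      have hyf' := hyf (by rw [permute_apply, hx])
      have := toSpace_permute (T.glue_symm _ _ _ _ hg) hyf'
      rw [← this]
      exact hsub t hy)
  have hWint : W ⊆ interior N := by
    refine interior_maximal (T.subset_of_preimage_subset fun t => ?_) (T.isOpen_of_preimage fun t => ?_)
    · rw [hW]
      exact hsub t
    · rw [hW]
      exact isOpen_iUnion (hopen t)
  have hinterior : T.toSpace t ⁻¹' interior N = ⋃ i, {x | 1 / 2 < height (h t i) i x} := by
    refine Set.Subset.antisymm (fun x hx => hint t 0 x ?_) ?_
    · filter_upwards [(isOpen_interior.preimage (T.continuous_toSpace t)).mem_nhds hx] with y hy _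
      exact interior_subset hy
    · rw [← hW]
      exact Set.preimage_mono hWint
  rw [hNclosed.frontier_eq, Set.preimage_sdiff, hN, hinterior]
  ext x
  simp only [Set.mem_sdiff, Set.mem_iUnion, Set.mem_ofPred_eq, not_exists, not_lt]
  constructor
  · rintro ⟨⟨i, hi⟩, hall⟩
    exact ⟨i, le_antisymm (hall i) hi⟩
  · rintro ⟨i, hi⟩
    refine ⟨⟨i, hi.ge⟩, fun j => ?_⟩
    by_cases hji : j = i
    · subst hji
      exact hi.le
    · by_contra! hj
      exact Set.disjoint_left.1 (hdis t hji) hj.le hi.ge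

theorem toSpace_vertex {V : T.Space} (hV : T.vertexSet = {V}) (t : Fin n) (i : Fin 4) :
    T.toSpace t (vertex i) = V := by
  have : T.toSpace t (vertex i) ∈ T.vertexSet := ⟨t, i, rfl⟩
  rwa [hV] at this

/-- The link of the only vertex, in terms of the corners around all tetrahedron vertices. -/
theorem isVertexLink_iff {V : T.Space} (hV : T.vertexSet = {V}) {L : Set T.Space} :
    T.IsVertexLink V L ↔ ∃ (N : Set T.Space) (h : Fin n → Fin 4 → Tetrahedron ≃ₜ Tetrahedron),
      (∀ t i, FacePreserving (h t i)) ∧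
      (∀ t, Pairwise fun i j =>
        Disjoint {x | 1 / 2 ≤ height (h t i) i x} {x | 1 / 2 ≤ height (h t j) j x}) ∧
      (∀ t, T.toSpace t ⁻¹' N = ⋃ i, {x | 1 / 2 ≤ height (h t i) i x}) ∧ L = frontier N := by
  have huniv (t) : {i | T.toSpace t (vertex i) = V} = Set.univ :=
    Set.eq_univ_of_forall fun i => toSpace_vertex hV t i
  constructor
  · rintro ⟨N, hN, hL⟩
    choose C hC hdis hpre using hN
    choose h hh hCh using hC
    have hCh' (t i) : C t i = {x | 1 / 2 ≤ height (h t i) i x} := by rw [hCh, image_corner]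
    refine ⟨N, h, hh, fun t i j hij => ?_, fun t => ?_, hL⟩
    · have : Disjoint (C t i) (C t j) := hdis t hij
      rwa [hCh', hCh'] at this
    · rw [hpre, huniv, Set.biUnion_univ]
      exact Set.iUnion_congr (hCh' t)
  · rintro ⟨N, h, hh, hdis, hN, hL⟩
    refine ⟨N, fun t => ⟨fun i => {x | 1 / 2 ≤ height (h t i) i x}, fun i => ?_, hdis t, ?_⟩, hL⟩
    · exact ⟨h t i, hh t i, (image_corner _ i).symm⟩
    · rw [hN, huniv, Set.biUnion_univ]

end GenTriangulation

/-! ### Normal surfaces compared with the vertex link -/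

namespace NormalSurface

open Tetrahedron GenTriangulation

variable {n : ℕ} {T : GenTriangulation n} (S : NormalSurface T)

theorem isClosed_of_mem_pieces {t : Fin n} {D : Set Tetrahedron} (hD : D ∈ S.pieces t) :
    IsClosed D := by
  obtain ⟨τ, hτ⟩ := S.pieces_normal t D hD
  exact hτ.isClosed

theorem vector_ne_zero_iff (t : Fin n) (τ : DiscType) :
    S.vector (t, τ) ≠ 0 ↔ {D | D ∈ S.pieces t ∧ IsNormalDisc τ D}.Nonempty := by
  have hfin : {D | D ∈ S.pieces t ∧ IsNormalDisc τ D}.Finite :=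
    (S.pieces_finite t).subset fun D hD => hD.1
  rw [vector, Nat.cast_ne_zero, Set.nonempty_iff_ne_empty]
  exact not_congr (Set.ncard_eq_zero hfin)

/-- If the discs of `S` in some tetrahedron have the same union as a finite disjoint family
of normal discs, then they include this family. -/
theorem mem_pieces_of_preimage_eq {t : Fin n} {D : Fin 4 → Set Tetrahedron}
    (hD : ∀ i, IsNormalDisc (.tri i) (D i)) (hdis : Pairwise fun i j => Disjoint (D i) (D j))
    (h : T.toSpace t ⁻¹' S.carrier = ⋃ i, D i) (i : Fin 4) : D i ∈ S.pieces t := by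
  have hcover : ⋃₀ S.pieces t = ⋃₀ Set.range D := by rw [← S.preimage_carrier, h, Set.sUnion_range]
  -- Each disc is connected, so `D i` lies in one piece `E`, and `E` in one `D j`; disjointness
  -- forces `i = j` and hence `E = D i`.
  obtain ⟨E, hE, hDE⟩ := (hD i).isPreconnected.subset_of_subset_sUnion_of_isClosed (hD i).nonempty
    (S.pieces_finite t) (S.pieces_disjoint t) (fun _ h => S.isClosed_of_mem_pieces h)
    (hcover ▸ Set.subset_sUnion_of_mem ⟨i, rfl⟩)
  obtain ⟨τ, hτ⟩ := S.pieces_normal t E hE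
  obtain ⟨_, ⟨j, rfl⟩, hED⟩ := hτ.isPreconnected.subset_of_subset_sUnion_of_isClosed hτ.nonempty
    (Set.finite_range D) (by
      rintro _ ⟨a, rfl⟩ _ ⟨b, rfl⟩ hab
      exact hdis fun e => hab (by rw [e]))
    (by rintro _ ⟨a, rfl⟩; exact (hD a).isClosed)
    (hcover ▸ Set.subset_sUnion_of_mem hE)
  have hij : i = j := by
    by_contra hij
    obtain ⟨x, hx⟩ := (hD i).nonempty
    exact Set.disjoint_left.1 (hdis hij) hx (hED (hDE hx))
  subst hij
  exact hDE.antisymm hED ▸ hE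

/-- The corners that the innermost triangles of `S` cut off match along the gluings. -/
theorem permute_mem_corner {h : Fin n → Fin 4 → Tetrahedron ≃ₜ Tetrahedron}
    (hh : ∀ t i, FacePreserving (h t i))
    (hpieces : ∀ t i, {x | height (h t i) i x = 1 / 2} ∈ S.pieces t)
    (hinner : ∀ t i, ∀ x ∈ ⋃₀ S.pieces t, height (h t i) i x ≤ 1 / 2)
    {t t' : Fin n} {f : Fin 4} {σ : Equiv.Perm (Fin 4)} (hg : T.glue t f = some (t', σ))
    {i : Fin 4} {x : Tetrahedron} (hxf : x.1 f = 0) (hx : 1 / 2 ≤ height (h t i) i x) :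
    1 / 2 ≤ height (h t' (σ i)) (σ i) (permute σ x) := by
  have hfi : i ≠ f := by
    rintro rfl
    rw [((hh t i).height_eq_zero i x).2 hxf] at hx
    norm_num at hx
  -- The inequality is strict because the triangle itself belongs to S. Points on it are recovered
  -- at the end by passing to the closure.
  set K : Set Tetrahedron := {y | height (h t i) i y ∈ Set.Ioi (1 / 2) ∧ y.1 f = 0} with hK
  have hKconn : IsPreconnected (permute σ '' K) :=
    ((hh t i).isPreconnected_height_facet i f (convex_Ioi _)).image _
      (continuous_permute σ).continuousOn
  have hvK : permute σ (vertex i) ∈ permute σ '' K := by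
    refine ⟨_, ⟨?_, vertex_ne hfi.symm⟩, rfl⟩
    rw [(hh t i).height_vertex]
    norm_num
  have hopen : ∀ y ∈ K, 1 / 2 < height (h t' (σ i)) (σ i) (permute σ y) := fun y hy => by
    refine hKconn.gt_of_forall_ne (continuous_height _ _) ?_ hvK ?_ ⟨y, hy, rfl⟩
    · rintro _ ⟨z, hz, rfl⟩ hz'
      have hzS : permute σ z ∈ T.toSpace t' ⁻¹' S.carrier := by
        rw [S.preimage_carrier]
        exact ⟨_, hpieces t' (σ i), hz'⟩
      rw [Set.mem_preimage, toSpace_permute hg hz.2] at hzS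
      have hzS' : z ∈ T.toSpace t ⁻¹' S.carrier := hzS
      rw [S.preimage_carrier] at hzS'
      exact absurd hz.1 (not_lt.2 (hinner t i z hzS'))
    · rw [permute_vertex, (hh _ _).height_vertex]
      norm_num
  have hcl : IsClosed {y | 1 / 2 ≤ height (h t' (σ i)) (σ i) (permute σ y)} :=
    isClosed_le continuous_const ((continuous_height _ _).comp (continuous_permute σ))
  exact closure_minimal (fun y hy => (hopen y hy).le) hcl ((hh t i).mem_closure_upper hx hxf)

theorem vector_ne_zero_of_isVertexLink {V : T.Space} (hV : T.vertexSet = {V})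
    (hL : T.IsVertexLink V S.carrier) (t : Fin n) (i : Fin 4) : S.vector (t, .tri i) ≠ 0 := by
  obtain ⟨N, h, hh, hdis, hN, hS⟩ := (isVertexLink_iff hV).1 hL
  rw [vector_ne_zero_iff]
  refine ⟨_, S.mem_pieces_of_preimage_eq (fun i => isNormalDisc_height (hh t i) i) ?_
    (hS ▸ preimage_frontier_of_corners hh hdis hN t) i, isNormalDisc_height (hh t i) i⟩
  exact fun i j hij => (hdis t hij).mono (fun x hx => le_of_eq (Eq.symm hx))
    fun x hx => le_of_eq (Eq.symm hx)

theorem isVertexLink_of_vector_ne_zero {V : T.Space} (hV : T.vertexSet = {V})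
    (hS : IsConnected S.carrier) (hvec : ∀ t i, S.vector (t, .tri i) ≠ 0) :
    T.IsVertexLink V S.carrier := by
  have hex (t i) := exists_innermost (S.pieces_finite t) (S.pieces_disjoint t) (S.pieces_normal t)
    ((S.vector_ne_zero_iff t _).1 (hvec t i))
  choose h hh hpieces hinner using hex
  -- A triangle at `j` meets the facet opposite `i`, where the height for `i` is 0 and not 1/2.
  have hne (t) {i j : Fin 4} (hij : i ≠ j) :
      {x | height (h t i) i x = 1 / 2} ≠ {x | height (h t j) j x = 1 / 2} := fun e => by
    obtain ⟨x, hx, hxi⟩ := (isNormalDisc_height (hh t j) j).exists_coord_eq_zero (i := i)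
      (fun e => hij (DiscType.tri.inj e).symm)
    rw [← e, Set.mem_ofPred_eq, ((hh t i).height_eq_zero i x).2 hxi] at hx
    norm_num at hx
  have hdis (t) : Pairwise fun i j =>
      Disjoint {x | 1 / 2 ≤ height (h t i) i x} {x | 1 / 2 ≤ height (h t j) j x} := fun i j hij =>
    disjoint_corners (hh t i) (hh t j) hij
      (S.pieces_disjoint t (hpieces t i) (hpieces t j) (hne t hij))
  obtain ⟨N, hN⟩ := exists_preimage_eq (T := T)
    (U := fun t => ⋃ i, {x | 1 / 2 ≤ height (h t i) i x}) fun t f t' σ hg x hxf hx => by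
      obtain ⟨i, hi⟩ := Set.mem_iUnion.1 hx
      exact Set.mem_iUnion.2 ⟨σ i, S.permute_mem_corner hh hpieces hinner hg hxf hi⟩
  refine (isVertexLink_iff hV).2 ⟨N, h, hh, hdis, hN, ?_⟩
  have hfr := preimage_frontier_of_corners hh hdis hN
  have hsub : frontier N ⊆ S.carrier := T.subset_of_preimage_subset fun t => by
    rw [hfr, S.preimage_carrier]
    exact Set.iUnion_subset fun i => Set.subset_sUnion_of_mem (hpieces t i)
  refine Set.Subset.antisymm ?_ hsub
  -- By disjointness, removing the innermost triangles leaves in each tetrahedron a finite union of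
  -- whole discs.
  have hrest : IsClosed (S.carrier \ frontier N) := T.isClosed_of_preimage fun t => by
    have : T.toSpace t ⁻¹' (S.carrier \ frontier N) =
        ⋃₀ (S.pieces t \ Set.range fun i => {x | height (h t i) i x = 1 / 2}) := by
      rw [Set.preimage_sdiff, hfr, S.preimage_carrier]
      ext x
      constructor
      · rintro ⟨⟨D, hD, hx⟩, hx'⟩
        refine ⟨D, ⟨hD, ?_⟩, hx⟩
        rintro ⟨i, rfl⟩
        exact hx' (Set.mem_iUnion.2 ⟨i, hx⟩)
      · rintro ⟨D, ⟨hD, hD'⟩, hx⟩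
        refine ⟨⟨D, hD, hx⟩, fun hx' => ?_⟩
        obtain ⟨i, hi⟩ := Set.mem_iUnion.1 hx'
        exact Set.disjoint_left.1
          (S.pieces_disjoint t hD (hpieces t i) fun e => hD' ⟨i, e.symm⟩) hx hi
    rw [this, Set.sUnion_eq_biUnion]
    exact ((S.pieces_finite t).subset Set.sdiff_subset).isClosed_biUnion
      fun D hD => S.isClosed_of_mem_pieces hD.1
  rcases isPreconnected_iff_subset_of_disjoint_closed.1 hS.isPreconnected (frontier N) _
    isClosed_frontier hrest (fun p hp => (Classical.em (p ∈ frontier N)).imp id fun h => ⟨hp, h⟩)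
    (by rw [Set.inter_sdiff_self, Set.inter_empty]) with hcase | hcase
  · exact hcase
  -- The existence of `V` supplies a tetrahedron, and its innermost triangle at vertex 0 shows that
  -- the frontier is non-empty.
  · obtain ⟨t, -, -⟩ : V ∈ T.vertexSet := by rw [hV]; rfl
    obtain ⟨x, hx⟩ := FacePreserving.nonempty_disc (h t 0) 0
    have hxN : x ∈ T.toSpace t ⁻¹' frontier N := by
      rw [hfr]
      exact Set.mem_iUnion.2 ⟨0, hx⟩
    exact absurd hxN (hcase (hsub hxN)).2

end NormalSurface

theorem lemma3p9 {n : ℕ} (T : GenTriangulation n) (hK : IsKnotComplement T.Space)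
    (V : T.Space) (hV : T.vertexSet = {V})
    (S : NormalSurface T) (hS : IsConnected S.carrier) :
    T.IsVertexLink V S.carrier ↔
      ∀ (t : Fin n) (i : Fin 4), S.vector (t, Tetrahedron.DiscType.tri i) ≠ 0 :=
  ⟨fun hL => S.vector_ne_zero_of_isVertexLink hV hL, S.isVertexLink_of_vector_ne_zero hV hS⟩
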